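/- Let $(X,d,\mu)$ be a complete metric space with at least two points, equipped with a doubling Borel regular measure $\mu$ ($0<\mu(B(x,2r))\le C\mu(B(x,r))<\infty$ for all balls) and supporting a $(1,1)$-Poincaré inequality. For an open set $U\subset X$, let $$\|Du\|(U)=\inf\Big\{\liminf_{i\to\infty}\int_U g_{i}\,d\mu\Big\},$$ where the infimum is over all sequences $u_i\in \mathrm{Lip}_{\mathrm{loc}}(U)$ with $u_i\to u$ in $L^1_{\mathrm{loc}}(U)$ and all upper gradients $g_i$ of $u_i$ in $U$; put $\|Du\|(A)=\inf\{\|Du\|(U): U\supset A \text{ open}\}$ for arbitrary $A\subset X$, $P(E,A)=\|D\chi_E\|(A)$, and $\mathrm{BV}(U)=\{u\in L^1(U):\|Du\|(U)<\infty\}$. For $E\subset X$ let $\partial^*E$ be the measure theoretic boundary, i.e. the set of points at which both $E$ and $X\setminus E$ have positive upper $\mu$-density, and let $\mathcal H$ be the codimension one Hausdorff measure, $\mathcal H(A)=\lim_{R\to0}\inf\sum_i \mu(B(x_i,r_i))/r_i$, where the infimum is over all countable (possibly finite) covers of $A$ by balls $B(x_i,r_i)$ with $r_i\le R$. Let $\Omega\subset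 X$ be a nonempty bounded open set with $P(\Omega,X)<\infty$ such that for every $u\in\mathrm{BV}(\Omega)$ the trace $Tu(x)$, i.e. the number with $$\lim_{r\to0}\frac1{\mu(B(x,r)\cap\Omega)}\int_{B(x,r)\cap\Omega}|u-Tu(x)|\,d\mu=0,$$ exists for $\mathcal H$-a.e. $x\in\partial^*\Omega$. Let $f\in L^1(\partial^*\Omega,P(\Omega,\cdot))$ with $\int_{\partial^*\Omega}f\,dP(\Omega,\cdot)=0$. For $u\in \mathrm{BV}(\Omega)$ put $$I(u)=\|Du\|(\Omega)+\int_{\partial^*\Omega}Tu\,f\,dP(\Omega,\cdot).$$ A function $u\in\mathrm{BV}(\Omega)$ solves the restricted Neumann problem with boundary data $f$ if $-1\le u\le1$ and $I(u)\le I(v)$ for all $v\in\mathrm{BV}(\Omega)$ with $-1\le v\le 1$. A function $u\in\mathrm{BV}_{\mathrm{loc}}(\Omega)$ is of least gradient in $\Omega$ if $\|Du\|(\Omega)\le\|D(u+\varphi)\|(\Omega)$ for every $\varphi\in\mathrm{BV}(\Omega)$ with compact support in $\Omega$. **Proposition.** Let $E_1,E_2\subset\Omega$ be disjoint sets such that $\chi_{E_1}-\chi_{E_2}$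 solves the restricted Neumann problem with boundary data $f$. Then $\chi_{E_1}$ and $\chi_{E_2}$ belong to $\mathrm{BV}(\Omega)$ and are functions of least gradient in $\Omega$. -/

import Mathlib

open MeasureTheory Set Filter Topology Metric
open scoped ENNReal NNReal

namespace MetricBV

variable {X : Type*} [MetricSpace X]

/-! ### Upper gradients, doubling, Poincaré inequality -/

/-- `g` is an upper gradient of `u` in `U`: `g` is a Borel function with values in `[0, ∞]` and
`|u(x) - u(y)| ≤ ∫_γ g ds` for every nonconstant rectifiable curve `γ` in `U` with end points
`x, y`. Every such curve is taken with its arc-length parametrization `γ : [0, ℓ] → U`, `ℓ > 0`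
(unit speed: the length of `γ` over `[s, t]` is `t - s`). Only the values of `u` and `g` on `U`
matter. -/
def IsUpperGradient [MeasurableSpace X] (u : X → ℝ) (g : X → ℝ≥0∞) (U : Set X) : Prop :=
  Measurable g ∧
    ∀ (ℓ : ℝ) (γ : ℝ → X), 0 < ℓ → HasUnitSpeedOn γ (Icc 0 ℓ) → MapsTo γ (Icc 0 ℓ) U →
      ‖u (γ 0) - u (γ ℓ)‖ₑ ≤ ∫⁻ s in Icc (0 : ℝ) ℓ, g (γ s)

/-- `μ` is doubling: `0 < μ(B(x,2r)) ≤ C μ(B(x,r)) < ∞` for all balls. -/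
def IsDoubling [MeasurableSpace X] (μ : Measure X) : Prop :=
  ∃ C : ℝ≥0, 1 ≤ C ∧ ∀ (x : X) (r : ℝ), 0 < r →
    0 < μ (ball x (2 * r)) ∧ μ (ball x (2 * r)) ≤ C * μ (ball x r) ∧ μ (ball x r) < ∞

/-- `X` supports a `(1,1)`-Poincaré inequality. -/
def SupportsPoincare [MeasurableSpace X] (μ : Measure X) : Prop :=
  ∃ C lam : ℝ, 0 < C ∧ 1 ≤ lam ∧ ∀ (x : X) (r : ℝ), 0 < r →
    ∀ (u : X → ℝ) (g : X → ℝ≥0∞), LocallyIntegrable u μ → IsUpperGradient u g univ →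
      ⨍⁻ y in ball x r, ‖u y - ⨍ z in ball x r, u z ∂μ‖ₑ ∂μ
        ≤ ENNReal.ofReal (C * r) * ⨍⁻ y in ball x (lam * r), g y ∂μ

/-! ### Total variation and functions of bounded variation -/

/-- `V ⋐ U` for an open set `V`: the closure of `V` is a compact subset of `U`. -/
def CompactlyInside (V U : Set X) : Prop :=
  IsOpen V ∧ IsCompact (closure V) ∧ closure V ⊆ U

/-- `v ∈ Lip_loc(U)`: `v` is Lipschitz in every open `V ⋐ U`. -/
def LipLoc (v : X → ℝ) (U : Set X) : Prop :=
  ∀ V, CompactlyInside V U → ∃ K : ℝ≥0, LipschitzOnWith K v V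

/-- `v i → u` in `L¹_loc(U)`. -/
def TendstoL1Loc [MeasurableSpace X] (μ : Measure X) (v : ℕ → X → ℝ) (u : X → ℝ)
    (U : Set X) : Prop :=
  ∀ V, CompactlyInside V U →
    Tendsto (fun i => ∫⁻ x in V, ‖v i x - u x‖ₑ ∂μ) atTop (𝓝 0)

/-- The total variation `‖Du‖(U)` of `u` in an open set `U`: the infimum of
`liminf ∫_U g_i dμ` over all `v_i ∈ Lip_loc(U)` with `v_i → u` in `L¹_loc(U)` and all upper
gradients `g_i` of `v_i` in `U`. -/
noncomputable def variation [MeasurableSpace X] (μ : Measure X) (u : X → ℝ) (U : Set X) : ℝ≥0∞ :=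
  ⨅ (v : ℕ → X → ℝ) (g : ℕ → X → ℝ≥0∞) (_ : ∀ i, LipLoc (v i) U)
    (_ : ∀ i, IsUpperGradient (v i) (g i) U) (_ : TendstoL1Loc μ v u U),
    liminf (fun i => ∫⁻ x in U, g i x ∂μ) atTop

/-- `u ∈ BV(U)`: `u ∈ L¹(U)` and `‖Du‖(U) < ∞`. -/
def MemBV [MeasurableSpace X] (μ : Measure X) (u : X → ℝ) (U : Set X) : Prop :=
  IntegrableOn u U μ ∧ variation μ u U < ∞

/-- `u ∈ BV_loc(U)`. -/
def MemBVLoc [MeasurableSpace X] (μ : Measure X) (u : X → ℝ) (U : Set X) : Prop :=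
  ∀ V, CompactlyInside V U → MemBV μ u V

/-- `u` is of least gradient in `U`: `u ∈ BV_loc(U)` and `‖Du‖(U) ≤ ‖D(u + φ)‖(U)` for every
`φ ∈ BV(U)` with compact support in `U`. -/
def IsLeastGradient [MeasurableSpace X] (μ : Measure X) (u : X → ℝ) (U : Set X) : Prop :=
  MemBVLoc μ u U ∧
    ∀ φ : X → ℝ, MemBV μ φ U → (∃ K, IsCompact K ∧ K ⊆ U ∧ ∀ x ∈ U \ K, φ x = 0) →
      variation μ u U ≤ variation μ (fun x => u x + φ x) U

/-- The characteristic function of `E`. -/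
noncomputable def chi (E : Set X) : X → ℝ := E.indicator fun _ => 1

/-! ### The perimeter measure -/

/-- `‖Du‖(A)` for an arbitrary set `A`, as the infimum of `‖Du‖(U)` over open `U ⊇ A`. -/
noncomputable def variationSet [MeasurableSpace X] (μ : Measure X) (u : X → ℝ)
    (A : Set X) : ℝ≥0∞ :=
  ⨅ (U : Set X) (_ : A ⊆ U) (_ : IsOpen U), variation μ u U

/-- The variation measure `‖Du‖(·)` on the Borel sets of `X`, obtained from the set function
`A ↦ ‖Du‖(A)` by Carathéodory's metric construction (countable covers by sets of small diameter).
The construction always yields a Borel measure, and it returns the set function itself as soon as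
that is countably additive on Borel sets, see `variationMeasure_eq`; for `u ∈ BV(X)` the latter is
the classical fact that `‖Du‖(·)` is a Radon measure. -/
noncomputable def variationMeasure [MeasurableSpace X] [BorelSpace X] (μ : Measure X)
    (u : X → ℝ) : Measure X :=
  Measure.mkMetric' (variationSet μ u)

/-- If `A ↦ ‖Du‖(A)` is given on Borel sets by a Borel measure `ν`, then `variationMeasure` is
this measure `ν`. -/
theorem variationMeasure_eq [MeasurableSpace X] [BorelSpace X] [SecondCountableTopology X]
    (μ : Measure X) (u : X → ℝ) (ν : Measure X)
    (h : ∀ A, MeasurableSet A → variationSet μ u A = ν A) : variationMeasure μ u = ν := by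
  have hle : ∀ s, ν s ≤ variationSet μ u s := by
    intro s
    refine le_iInf fun U => le_iInf fun hsU => le_iInf fun hU => ?_
    calc ν s ≤ ν U := measure_mono hsU
      _ = variationSet μ u U := (h U hU.measurableSet).symm
      _ ≤ variation μ u U := iInf_le_of_le U (iInf_le_of_le subset_rfl (iInf_le_of_le hU le_rfl))
  ext A hA
  rw [variationMeasure, Measure.mkMetric', toMeasure_apply _ _ hA]
  apply le_antisymm
  · rw [OuterMeasure.mkMetric', OuterMeasure.iSup_apply]
    refine iSup_le fun r => ?_
    rw [OuterMeasure.iSup_apply]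
    refine iSup_le fun hr => ?_
    obtain ⟨ε, hε, hεr⟩ : ∃ ε : ℝ≥0∞, 0 < ε ∧ 2 * ε ≤ r :=
      ⟨r / 2, ENNReal.half_pos hr.ne', by rw [ENNReal.mul_div_cancel (by simp) (by simp)]⟩
    obtain ⟨s, hs, hcov⟩ := TopologicalSpace.countable_cover_nhds
      (fun x : X => Metric.eball_mem_nhds x hε)
    rcases s.eq_empty_or_nonempty with rfl | hne
    · have : A = ∅ := by
        rw [biUnion_empty] at hcov
        exact subset_eq_empty ((subset_univ A).trans hcov.symm.subset) rfl
      simp [this]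
    obtain ⟨f, rfl⟩ := hs.exists_eq_range hne
    set B : ℕ → Set X := fun n => Metric.eball (f n) ε with hB
    have hBm : ∀ n, MeasurableSet (B n) := fun n => Metric.isOpen_eball.measurableSet
    have hBU : ⋃ n, B n = univ := by rw [← hcov, biUnion_range, hB]
    set D : ℕ → Set X := fun n => A ∩ disjointed B n with hD
    have hDm : ∀ n, MeasurableSet (D n) :=
      fun n => hA.inter (MeasurableSet.disjointed hBm n)
    have hDA : ⋃ n, D n = A := by
      rw [hD, ← inter_iUnion, iUnion_disjointed, hBU, inter_univ]
    have hDd : Pairwise (Function.onFun Disjoint D) := fun i j hij =>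
      (disjoint_disjointed B hij).mono inter_subset_right inter_subset_right
    calc OuterMeasure.mkMetric'.pre (variationSet μ u) r A
        = OuterMeasure.mkMetric'.pre (variationSet μ u) r (⋃ n, D n) := by rw [hDA]
      _ ≤ ∑' n, OuterMeasure.mkMetric'.pre (variationSet μ u) r (D n) := measure_iUnion_le _
      _ ≤ ∑' n, ν (D n) := by
          refine ENNReal.tsum_le_tsum fun n => ?_
          rw [← h _ (hDm n)]
          refine OuterMeasure.mkMetric'.pre_le ?_
          have hsub : D n ⊆ B n := inter_subset_right.trans (disjointed_subset B n)
          exact (ediam_mono hsub).trans (Metric.ediam_eball_le.trans hεr)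
      _ = ν A := by rw [← measure_iUnion hDd hDm, hDA]
  · have h1 : ν.toOuterMeasure ≤ OuterMeasure.mkMetric' (variationSet μ u) :=
      le_iSup₂_of_le (1 : ℝ≥0∞) one_pos
        (OuterMeasure.mkMetric'.le_pre.2 fun s _ => hle s)
    exact h1 A

/-- The perimeter measure `P(Ω, ·)`. -/
noncomputable def perimeterMeasure [MeasurableSpace X] [BorelSpace X] (μ : Measure X)
    (Ω : Set X) : Measure X :=
  variationMeasure μ (chi Ω)

/-! ### Codimension one Hausdorff measure, measure theoretic boundary, traces -/

/-- The restricted spherical Hausdorff content of codimension `1`, an infimum over covers of `A`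
by countably many (possibly finitely many) balls of radii at most `R`. -/
noncomputable def codimOneContent [MeasurableSpace X] (μ : Measure X) (R : ℝ) (A : Set X) : ℝ≥0∞ :=
  ⨅ (I : Set ℕ) (c : ℕ → X) (r : ℕ → ℝ) (_ : ∀ i ∈ I, 0 < r i ∧ r i ≤ R)
    (_ : A ⊆ ⋃ i ∈ I, ball (c i) (r i)),
    ∑' i : I, μ (ball (c i) (r i)) / ENNReal.ofReal (r i)

/-- The codimension `1` Hausdorff measure: the limit of the contents as `R → 0`, which is their
supremum over `R > 0` because the content increases as `R` decreases. -/
noncomputable def codimOneHausdorff [MeasurableSpace X] (μ : Measure X) (A : Set X) : ℝ≥0∞ :=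
  ⨆ (R : ℝ) (_ : 0 < R), codimOneContent μ R A

/-- The measure theoretic boundary `∂^*E`: both `E` and its complement have positive upper
density. -/
noncomputable def measureBoundary [MeasurableSpace X] (μ : Measure X) (E : Set X) : Set X :=
  {x | 0 < limsup (fun r : ℝ => μ (ball x r ∩ E) / μ (ball x r)) (𝓝[>] 0) ∧
    0 < limsup (fun r : ℝ => μ (ball x r \ E) / μ (ball x r)) (𝓝[>] 0)}

/-- The number `t` is the trace of `u` at the point `x ∈ ∂Ω`. -/
def IsTrace [MeasurableSpace X] (μ : Measure X) (Ω : Set X) (u : X → ℝ) (x : X) (t : ℝ) : Prop :=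
  Tendsto (fun r : ℝ => ⨍⁻ y in ball x r ∩ Ω, ‖u y - t‖ₑ ∂μ) (𝓝[>] 0) (𝓝 0)

open Classical in
/-- The trace `Tu`, with the value `0` at points where the trace does not exist. -/
noncomputable def trace [MeasurableSpace X] (μ : Measure X) (Ω : Set X) (u : X → ℝ) (x : X) : ℝ :=
  if h : ∃ t, IsTrace μ Ω u x t then h.choose else 0

/-! ### The restricted Neumann problem -/

/-- The functional `I(u) = ‖Du‖(Ω) + ∫_{∂^*Ω} Tu f dP(Ω, ·)`, for `u ∈ BV(Ω)`. -/
noncomputable def neumannFunctional [MeasurableSpace X] [BorelSpace X] (μ : Measure X)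
    (Ω : Set X) (f : X → ℝ) (u : X → ℝ) : ℝ :=
  (variation μ u Ω).toReal +
    ∫ x in measureBoundary μ Ω, trace μ Ω u x * f x ∂(perimeterMeasure μ Ω)

/-- `u` solves the restricted Neumann problem with boundary data `f`: among all functions
`v ∈ BV(Ω)` with `-1 ≤ v ≤ 1`, the function `u` minimizes `I`. -/
def SolvesRestrictedNeumann [MeasurableSpace X] [BorelSpace X] (μ : Measure X) (Ω : Set X)
    (f : X → ℝ) (u : X → ℝ) : Prop :=
  MemBV μ u Ω ∧ (∀ x ∈ Ω, -1 ≤ u x ∧ u x ≤ 1) ∧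
    ∀ v : X → ℝ, MemBV μ v Ω → (∀ x ∈ Ω, -1 ≤ v x ∧ v x ≤ 1) →
      neumannFunctional μ Ω f u ≤ neumannFunctional μ Ω f v

end MetricBV

namespace MetricBV

variable {X : Type*} [MetricSpace X]

/-! ### Doubling spaces are proper -/

/-! Write `u = χ_{E₁} - χ_{E₂}`. Since the sets are disjoint, `χ_{E₁}` and `χ_{E₂}` are the positive
and negative parts of `u`, and total variation splits along them: `‖Du⁺‖(Ω) + ‖Du⁻‖(Ω) ≤ ‖Du‖(Ω)`
(`variation_posPart_add_negPart_le`). No coarea formula is needed: an upper gradient of a continuous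
`v` remains one for `v⁺` after being set to zero off `{v > 0}` (`IsUpperGradient.posPart`), and `{v
> 0}` and `{v < 0}` are disjoint.

Let `w` be a competitor for `χ_{E₁}` that agrees with it off a compact `K ⊆ Ω`. Truncation allows `0
≤ w ≤ 1` (`isLeastGradient_of_forall_le`), so `w - χ_{E₂}` takes values in `[-1, 1]`. It equals `u`
near `∂^*Ω`, hence has the same trace there, and minimality of `u` reduces to `‖Du‖(Ω) ≤ ‖D(w -
χ_{E₂})‖(Ω)` (`SolvesRestrictedNeumann.variation_le`). Therefore `‖Dχ_{E₁}‖ + ‖Dχ_{E₂}‖ ≤ ‖Du‖ ≤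
‖D(w - χ_{E₂})‖ ≤ ‖Dw‖ + ‖Dχ_{E₂}‖`, and the finite term `‖Dχ_{E₂}‖` cancels. The argument for `E₂`
is symmetric. -/

theorem IsDoubling.measure_ball_pos [MeasurableSpace X] {μ : Measure X} (h : IsDoubling μ)
    (x : X) {r : ℝ} (hr : 0 < r) : 0 < μ (ball x r) := by
  obtain ⟨C, -, h⟩ := h
  have := (h x (r / 2) (half_pos hr)).1
  rwa [mul_div_cancel₀ r two_ne_zero] at this

theorem IsDoubling.measure_ball_lt_top [MeasurableSpace X] {μ : Measure X} (h : IsDoubling μ)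
    (x : X) (r : ℝ) : μ (ball x r) < ∞ := by
  obtain ⟨C, -, h⟩ := h
  exact (measure_mono (ball_subset_ball (le_max_left r 1))).trans_lt
    (h x (max r 1) (lt_max_of_lt_right one_pos)).2.2

theorem IsDoubling.exists_measure_ball_two_pow_le [MeasurableSpace X] {μ : Measure X}
    (h : IsDoubling μ) : ∃ C : ℝ≥0, 1 ≤ C ∧ ∀ (n : ℕ) (x : X) (r : ℝ), 0 < r →
      μ (ball x (2 ^ n * r)) ≤ (C : ℝ≥0∞) ^ n * μ (ball x r) := by
  obtain ⟨C, hC, h⟩ := h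
  refine ⟨C, hC, fun n x r hr => ?_⟩
  induction n with
  | zero => simp
  | succ n ih =>
    calc μ (ball x (2 ^ (n + 1) * r)) = μ (ball x (2 * (2 ^ n * r))) := by ring_nf
      _ ≤ C * μ (ball x (2 ^ n * r)) := (h x _ (by positivity)).2.1
      _ ≤ C * ((C : ℝ≥0∞) ^ n * μ (ball x r)) := by gcongr
      _ = (C : ℝ≥0∞) ^ (n + 1) * μ (ball x r) := by ring

/-- A maximal `ε/2`-separated subset of the ball is an `ε`-net. The balls of radius `ε/4` about its
points are disjoint, lie in one ball of finite measure, and by doubling have measure bounded below,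
so there are finitely many. -/
theorem IsDoubling.totallyBounded_ball [MeasurableSpace X] [BorelSpace X] {μ : Measure X}
    (h : IsDoubling μ) (x : X) (R : ℝ) : TotallyBounded (ball x R) := by
  rcases le_or_gt R 0 with hR | hR
  · simp [ball_eq_empty.2 hR]
  refine Metric.totallyBounded_iff.2 fun ε hε => ?_
  set δ : ℝ≥0 := ⟨ε / 2, (half_pos hε).le⟩ with hδ
  obtain ⟨N, hN⟩ := zorn_subset {N : Set X | N ⊆ ball x R ∧ IsSeparated δ N} (by
    intro c hc hchain
    exact ⟨⋃₀ c, ⟨sUnion_subset fun s hs => (hc hs).1,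
      hchain.pairwise_sUnion.2 fun s hs => (hc hs).2⟩, fun s hs => subset_sUnion_of_mem hs⟩)
  have hcov := isCover_iff_subset_iUnion_closedBall.1 (IsCover.of_maximal_isSeparated hN)
  refine ⟨N, ?_, hcov.trans (iUnion₂_mono fun y _ => closedBall_subset_ball ?_)⟩
  swap
  · change ε / 2 < ε
    linarith
  obtain ⟨C, hC, hpow⟩ := h.exists_measure_ball_two_pow_le
  -- After `n` doublings, a ball of radius `ε/4` about any point of `N` contains `ball x R`.
  obtain ⟨n, hn⟩ := pow_unbounded_of_one_lt (2 * R / (ε / 4)) one_lt_two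
  have hn' : 2 * R ≤ 2 ^ n * (ε / 4) := ((div_lt_iff₀ (by positivity)).1 hn).le
  have hC0 : (C : ℝ≥0∞) ^ n ≠ 0 := pow_ne_zero _ (by
    simpa using (one_pos.trans_le hC).ne')
  have hCt : (C : ℝ≥0∞) ^ n ≠ ∞ := ENNReal.pow_ne_top ENNReal.coe_ne_top
  have hle : ∀ y : N, μ (ball x R) / (C : ℝ≥0∞) ^ n ≤ μ (ball (y : X) (ε / 4)) := by
    intro y
    refine ENNReal.div_le_of_le_mul' ((measure_mono ?_).trans (hpow n y (ε / 4) (by positivity)))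
    refine ball_subset_ball' ?_
    have : dist (y : X) x < R := hN.prop.1 y.2
    rw [dist_comm] at this
    linarith
  have hfin := Measure.finite_const_le_meas_of_disjoint_iUnion μ
    (ε := μ (ball x R) / (C : ℝ≥0∞) ^ n) (As := fun y : N => ball (y : X) (ε / 4))
    (ENNReal.div_pos (h.measure_ball_pos x hR).ne' hCt) (fun _ => measurableSet_ball)
    (by
      intro y z hyz
      refine ball_disjoint_ball ?_
      have : (δ : ℝ≥0∞) < edist (y : X) z :=
        hN.prop.2 y.2 z.2 fun h => hyz (Subtype.ext h)
      rw [edist_nndist, ENNReal.coe_lt_coe, ← NNReal.coe_lt_coe, coe_nndist] at this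
      have h2 : (δ : ℝ) = ε / 2 := rfl
      linarith)
    (((measure_mono (iUnion_subset fun y => ball_subset_ball' ?_)).trans_lt
      (h.measure_ball_lt_top x (ε / 4 + R))).ne)
  · have huniv : {y : N | μ (ball x R) / (C : ℝ≥0∞) ^ n ≤ μ (ball (y : X) (ε / 4))} = univ :=
      eq_univ_of_forall hle
    rw [huniv] at hfin
    exact Set.finite_coe_iff.1 (Set.finite_univ_iff.1 hfin)
  · have : dist (y : X) x < R := hN.prop.1 y.2
    linarith

theorem IsDoubling.properSpace [CompleteSpace X] [MeasurableSpace X] [BorelSpace X]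
    {μ : Measure X} (h : IsDoubling μ) : ProperSpace X :=
  ⟨fun x r => TotallyBounded.isCompact_of_isClosed
    ((h.totallyBounded_ball x (r + 1)).subset (closedBall_subset_ball (by linarith)))
    isClosed_closedBall⟩

/-! ### Locally Lipschitz functions and `L¹_loc` convergence -/

theorem CompactlyInside.mono {V U W : Set X} (h : CompactlyInside V U) (hUW : U ⊆ W) :
    CompactlyInside V W :=
  ⟨h.1, h.2.1, h.2.2.trans hUW⟩

theorem CompactlyInside.subset {V U : Set X} (h : CompactlyInside V U) : V ⊆ U :=
  subset_closure.trans h.2.2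

theorem LipLoc.mono {v : X → ℝ} {U W : Set X} (h : LipLoc v W) (hUW : U ⊆ W) : LipLoc v U :=
  fun V hV => h V (hV.mono hUW)

/-- `LipLoc` says something only on sets with compact closure in `U`; properness makes small balls
such sets. -/
theorem LipLoc.continuousOn [ProperSpace X] {v : X → ℝ} {U : Set X} (h : LipLoc v U)
    (hU : IsOpen U) : ContinuousOn v U := by
  intro x hx
  obtain ⟨r, hr, hrU⟩ := Metric.nhds_basis_closedBall.mem_iff.1 (hU.mem_nhds hx)
  obtain ⟨K, hK⟩ := h (ball x r) ⟨isOpen_ball,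
    (isCompact_closedBall x r).of_isClosed_subset isClosed_closure closure_ball_subset_closedBall,
    closure_ball_subset_closedBall.trans hrU⟩
  exact (hK.continuousOn.continuousAt (ball_mem_nhds x hr)).continuousWithinAt

theorem LipLoc.comp {v : X → ℝ} {U : Set X} (h : LipLoc v U) {T : ℝ → ℝ} {c : ℝ≥0}
    (hT : LipschitzWith c T) : LipLoc (fun x => T (v x)) U := by
  intro V hV
  obtain ⟨K, hK⟩ := h V hV
  exact ⟨c * K, hT.comp_lipschitzOnWith hK⟩

theorem LipLoc.add {v w : X → ℝ} {U : Set X} (hv : LipLoc v U) (hw : LipLoc w U) :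
    LipLoc (fun x => v x + w x) U := by
  intro V hV
  obtain ⟨K, hK⟩ := hv V hV
  obtain ⟨L, hL⟩ := hw V hV
  exact ⟨K + L, hK.add hL⟩

theorem TendstoL1Loc.mono [MeasurableSpace X] {μ : Measure X} {v : ℕ → X → ℝ} {u : X → ℝ}
    {U W : Set X} (h : TendstoL1Loc μ v u W) (hUW : U ⊆ W) : TendstoL1Loc μ v u U :=
  fun V hV => h V (hV.mono hUW)

theorem TendstoL1Loc.comp_tendsto [MeasurableSpace X] {μ : Measure X} {v : ℕ → X → ℝ} {u : X → ℝ}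
    {U : Set X} (h : TendstoL1Loc μ v u U) {k : ℕ → ℕ} (hk : Tendsto k atTop atTop) :
    TendstoL1Loc μ (fun i => v (k i)) u U :=
  fun V hV => (h V hV).comp hk

theorem _root_.LipschitzWith.enorm_sub_le {T : ℝ → ℝ} (hT : LipschitzWith 1 T) (a b : ℝ) :
    ‖T a - T b‖ₑ ≤ ‖a - b‖ₑ := by
  simpa [edist_eq_enorm_sub] using hT.edist_le_mul a b

theorem TendstoL1Loc.comp_lipschitz [MeasurableSpace X] {μ : Measure X} {v : ℕ → X → ℝ}
    {u : X → ℝ} {U : Set X} (h : TendstoL1Loc μ v u U) {T : ℝ → ℝ} (hT : LipschitzWith 1 T) :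
    TendstoL1Loc μ (fun i x => T (v i x)) (fun x => T (u x)) U :=
  fun V hV => tendsto_of_tendsto_of_tendsto_of_le_of_le tendsto_const_nhds (h V hV)
    (fun _ => zero_le) fun _ => lintegral_mono fun _ => hT.enorm_sub_le _ _

/-- Splitting the integral of a sum needs measurability of one summand only, so nothing is asked of
`w` and `b`. -/
theorem TendstoL1Loc.add [MeasurableSpace X] [BorelSpace X] {μ : Measure X} {v w : ℕ → X → ℝ}
    {a b : X → ℝ} {U : Set X} (hv : TendstoL1Loc μ v a U) (hw : TendstoL1Loc μ w b U)
    (hvc : ∀ i, ContinuousOn (v i) U) (ha : AEMeasurable a (μ.restrict U)) :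
    TendstoL1Loc μ (fun i x => v i x + w i x) (fun x => a x + b x) U := by
  intro V hV
  have h0 := (hv V hV).add (hw V hV)
  rw [add_zero] at h0
  refine tendsto_of_tendsto_of_tendsto_of_le_of_le tendsto_const_nhds h0
    (fun _ => zero_le) fun i => ?_
  have hm : AEMeasurable (fun x => ‖v i x - a x‖ₑ) (μ.restrict V) :=
    ((((hvc i).mono hV.subset).aemeasurable hV.1.measurableSet).sub
      (ha.mono_measure (Measure.restrict_mono hV.subset le_rfl))).enorm
  dsimp only
  rw [← lintegral_add_left' hm]
  refine lintegral_mono fun x => ?_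
  rw [add_sub_add_comm]
  exact enorm_add_le _ _

/-! ### Upper gradients -/

theorem IsUpperGradient.mono_set [MeasurableSpace X] {u : X → ℝ} {g : X → ℝ≥0∞} {U W : Set X}
    (h : IsUpperGradient u g W) (hUW : U ⊆ W) : IsUpperGradient u g U :=
  ⟨h.1, fun ℓ γ hℓ hγ hU => h.2 ℓ γ hℓ hγ (hU.mono_right hUW)⟩

theorem IsUpperGradient.comp_lipschitz [MeasurableSpace X] {u : X → ℝ} {g : X → ℝ≥0∞} {U : Set X}
    (h : IsUpperGradient u g U) {T : ℝ → ℝ} (hT : LipschitzWith 1 T) :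
    IsUpperGradient (fun x => T (u x)) g U :=
  ⟨h.1, fun ℓ γ hℓ hγ hU => (hT.enorm_sub_le _ _).trans (h.2 ℓ γ hℓ hγ hU)⟩

theorem IsUpperGradient.add [MeasurableSpace X] {u v : X → ℝ} {g k : X → ℝ≥0∞} {U : Set X}
    (hu : IsUpperGradient u g U) (hv : IsUpperGradient v k U) :
    IsUpperGradient (fun x => u x + v x) (fun x => g x + k x) U := by
  refine ⟨hu.1.add hv.1, fun ℓ γ hℓ hγ hU => ?_⟩
  rw [add_sub_add_comm]
  exact (enorm_add_le _ _).trans ((add_le_add (hu.2 ℓ γ hℓ hγ hU) (hv.2 ℓ γ hℓ hγ hU)).trans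
    (le_lintegral_add _ _))

/-- Distance is at most the length of the curve in between, so a unit speed curve is 1-Lipschitz. -/
theorem _root_.HasUnitSpeedOn.continuousOn {γ : ℝ → X} {s : Set ℝ} (h : HasUnitSpeedOn γ s) :
    ContinuousOn γ s := by
  have key : ∀ x ∈ s, ∀ y ∈ s, x ≤ y → edist (γ x) (γ y) ≤ edist x y := by
    intro x hx y hy hxy
    have h1 := eVariationOn.edist_le γ (s := s ∩ Icc x y) ⟨hx, le_rfl, hxy⟩ ⟨hy, hxy, le_rfl⟩
    rw [h hx hy, NNReal.coe_one, one_mul] at h1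
    rwa [edist_comm x y, edist_dist y x, Real.dist_eq, abs_of_nonneg (sub_nonneg.2 hxy)]
  have : LipschitzOnWith 1 γ s := by
    intro x hx y hy
    rw [ENNReal.coe_one, one_mul]
    rcases le_total x y with hxy | hxy
    · exact key x hx y hy hxy
    · rw [edist_comm, edist_comm x]
      exact key y hy x hx hxy
  exact this.continuousOn

theorem _root_.HasUnitSpeedOn.comp_add_const {γ : ℝ → X} {ℓ s t : ℝ}
    (h : HasUnitSpeedOn γ (Icc 0 ℓ)) (hs : 0 ≤ s) (ht : t ≤ ℓ) :
    HasUnitSpeedOn (fun τ => γ (τ + s)) (Icc 0 (t - s)) := by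
  intro x hx y hy
  have hmono : MonotoneOn (fun τ : ℝ => τ + s) (Icc 0 (t - s) ∩ Icc x y) :=
    fun a _ b _ hab => add_le_add_left hab s
  have h1 := eVariationOn.comp_eq_of_monotoneOn γ (fun τ : ℝ => τ + s) hmono
  have h2 : (fun τ : ℝ => τ + s) '' (Icc 0 (t - s) ∩ Icc x y) =
      Icc 0 ℓ ∩ Icc (x + s) (y + s) := by
    rw [inter_eq_right.2 (Icc_subset_Icc hx.1 hy.2), image_add_const_Icc,
      inter_eq_right.2 (Icc_subset_Icc (by linarith [hx.1]) (by linarith [hy.2]))]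
  have h3 := h (x := x + s) ⟨by linarith [hx.1], by linarith [hx.2]⟩ (y := y + s)
    ⟨by linarith [hy.1], by linarith [hy.2]⟩
  rw [h2, h3, add_sub_add_right_eq_sub] at h1
  exact h1

/-- The definition tests curves parametrized from `0`; subcurves are reached by translating the
parameter. -/
theorem IsUpperGradient.enorm_sub_le_setLIntegral [MeasurableSpace X] {u : X → ℝ}
    {g : X → ℝ≥0∞} {U : Set X} (h : IsUpperGradient u g U) {ℓ : ℝ} {γ : ℝ → X}
    (hγ : HasUnitSpeedOn γ (Icc 0 ℓ)) (hU : MapsTo γ (Icc 0 ℓ) U) {s t : ℝ} (hs : 0 ≤ s)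
    (hst : s ≤ t) (ht : t ≤ ℓ) :
    ‖u (γ s) - u (γ t)‖ₑ ≤ ∫⁻ τ in Icc s t, g (γ τ) := by
  rcases hst.eq_or_lt with rfl | hlt
  · simp
  have h1 := h.2 (t - s) (fun τ => γ (τ + s)) (sub_pos.2 hlt) (hγ.comp_add_const hs ht)
    fun τ hτ => hU ⟨by linarith [hτ.1], by linarith [hτ.2]⟩
  have h2 := (measurePreserving_add_right volume s).setLIntegral_comp_preimage_emb
    (measurableEmbedding_addRight s) (fun τ => g (γ τ)) (Icc s t)
  rw [preimage_add_const_Icc, sub_self] at h2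
  rw [h2] at h1
  simpa using h1

/-- The change of the positive part of a continuous function over an interval is controlled by
the change of the function over a subinterval on which it is positive. -/
theorem _root_.ContinuousOn.exists_Ioo_pos_abs_posPart_sub_le {φ : ℝ → ℝ} {a b : ℝ} (hab : a ≤ b)
    (hφ : ContinuousOn φ (Icc a b)) :
    ∃ s t, a ≤ s ∧ s ≤ t ∧ t ≤ b ∧ (∀ τ ∈ Ioo s t, 0 < φ τ) ∧
      |max (φ a) 0 - max (φ b) 0| ≤ |φ s - φ t| := by
  by_cases hpos : ∀ τ ∈ Icc a b, 0 < φ τ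
  · refine ⟨a, b, le_rfl, hab, le_rfl, fun τ hτ => hpos τ (Ioo_subset_Icc_self hτ), ?_⟩
    rw [max_eq_left (hpos a (left_mem_Icc.2 hab)).le, max_eq_left (hpos b (right_mem_Icc.2 hab)).le]
  have hZc : IsCompact (Icc a b ∩ φ ⁻¹' Iic 0) :=
    isCompact_Icc.of_isClosed_subset (hφ.preimage_isClosed_of_isClosed isClosed_Icc isClosed_Iic)
      inter_subset_left
  have hZne : (Icc a b ∩ φ ⁻¹' Iic 0).Nonempty := by
    push Not at hpos
    obtain ⟨τ, hτ, h0⟩ := hpos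
    exact ⟨τ, hτ, h0⟩
  -- If the positive part decreases, stop at the first point where `φ ≤ 0`: replacing `max (φ b) 0`
  -- by a nonpositive value only enlarges the drop. If it increases, start at the last such point.
  rcases le_total (max (φ b) 0) (max (φ a) 0) with hle | hle
  · obtain ⟨t, ⟨htI, ht0⟩, hleast⟩ := hZc.exists_isLeast hZne
    refine ⟨a, t, le_rfl, htI.1, htI.2, fun τ hτ => ?_, ?_⟩
    · by_contra hneg
      exact hτ.2.not_ge (hleast ⟨⟨hτ.1.le, hτ.2.le.trans htI.2⟩, not_lt.1 hneg⟩)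
    · rw [abs_of_nonneg (sub_nonneg.2 hle)]
      have h1 : φ t ≤ 0 := ht0
      have h2 := le_max_right (φ b) 0
      rcases le_total (φ a) 0 with h3 | h3
      · rw [max_eq_right h3]
        linarith [abs_nonneg (φ a - φ t)]
      · rw [max_eq_left h3]
        linarith [le_abs_self (φ a - φ t)]
  · obtain ⟨s, ⟨hsI, hs0⟩, hgreatest⟩ := hZc.exists_isGreatest hZne
    refine ⟨s, b, hsI.1, hsI.2, le_rfl, fun τ hτ => ?_, ?_⟩
    · by_contra hneg
      exact hτ.1.not_ge (hgreatest ⟨⟨hsI.1.trans hτ.1.le, hτ.2.le⟩, not_lt.1 hneg⟩)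
    · rw [abs_sub_comm, abs_of_nonneg (sub_nonneg.2 hle), abs_sub_comm]
      have h1 : φ s ≤ 0 := hs0
      have h2 := le_max_right (φ a) 0
      rcases le_total (φ b) 0 with h3 | h3
      · rw [max_eq_right h3]
        linarith [abs_nonneg (φ b - φ s)]
      · rw [max_eq_left h3]
        linarith [le_abs_self (φ b - φ s)]

/-- Along a curve, the change of `v⁺` is bounded by the change of `v` over a subcurve inside `{v >
0}`, where cutting off `g` changes nothing. Continuity of `v` makes `U ∩ {v > 0}` open, so the
cut-off function is Borel. -/
theorem IsUpperGradient.posPart [MeasurableSpace X] [BorelSpace X] {v : X → ℝ}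
    {g : X → ℝ≥0∞} {U : Set X} (h : IsUpperGradient v g U) (hU : IsOpen U)
    (hv : ContinuousOn v U) :
    IsUpperGradient (fun x => max (v x) 0) ((U ∩ {x | 0 < v x}).indicator g) U := by
  refine ⟨h.1.indicator (hv.isOpen_inter_preimage hU isOpen_Ioi).measurableSet,
    fun ℓ γ hℓ hγ hγU => ?_⟩
  obtain ⟨s, t, hs, hst, ht, hpos, hle⟩ :=
    (hv.comp hγ.continuousOn hγU).exists_Ioo_pos_abs_posPart_sub_le hℓ.le
  calc ‖max (v (γ 0)) 0 - max (v (γ ℓ)) 0‖ₑ ≤ ‖v (γ s) - v (γ t)‖ₑ := enorm_le_iff_norm_le.2 hle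
    _ ≤ ∫⁻ τ in Icc s t, g (γ τ) := h.enorm_sub_le_setLIntegral hγ hγU hs hst ht
    -- `v` may vanish at the end points of the subcurve; these are negligible.
    _ = ∫⁻ τ in Ioo s t, g (γ τ) := by rw [restrict_Ioo_eq_restrict_Icc]
    _ = ∫⁻ τ in Ioo s t, (U ∩ {x | 0 < v x}).indicator g (γ τ) := by
        refine setLIntegral_congr_fun measurableSet_Ioo fun τ hτ => ?_
        rw [indicator_of_mem]
        exact ⟨hγU ⟨hs.trans hτ.1.le, hτ.2.le.trans ht⟩, hpos τ hτ⟩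
    _ ≤ ∫⁻ τ in Icc 0 ℓ, (U ∩ {x | 0 < v x}).indicator g (γ τ) :=
        lintegral_mono_set (Ioo_subset_Icc_self.trans (Icc_subset_Icc hs ht))

/-! ### The total variation -/

theorem variation_le_liminf [MeasurableSpace X] {μ : Measure X} {u : X → ℝ} {U : Set X}
    {v : ℕ → X → ℝ} {g : ℕ → X → ℝ≥0∞} (hv : ∀ i, LipLoc (v i) U)
    (hg : ∀ i, IsUpperGradient (v i) (g i) U) (hvu : TendstoL1Loc μ v u U) :
    variation μ u U ≤ liminf (fun i => ∫⁻ x in U, g i x ∂μ) atTop :=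
  iInf_le_of_le v <| iInf_le_of_le g <| iInf_le_of_le hv <| iInf_le_of_le hg <|
    iInf_le_of_le hvu le_rfl

theorem le_variation [MeasurableSpace X] {μ : Measure X} {u : X → ℝ} {U : Set X} {c : ℝ≥0∞}
    (h : ∀ (v : ℕ → X → ℝ) (g : ℕ → X → ℝ≥0∞), (∀ i, LipLoc (v i) U) →
      (∀ i, IsUpperGradient (v i) (g i) U) → TendstoL1Loc μ v u U →
      c ≤ liminf (fun i => ∫⁻ x in U, g i x ∂μ) atTop) :
    c ≤ variation μ u U :=
  le_iInf fun v => le_iInf fun g => le_iInf fun hv => le_iInf fun hg => le_iInf fun hvu =>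
    h v g hv hg hvu

/-- Passing to a subsequence turns a bound on the liminf into a bound for every index. This is
needed for subadditivity of the variation, since liminf is not subadditive. -/
theorem exists_approx_of_variation_lt [MeasurableSpace X] {μ : Measure X} {u : X → ℝ} {U : Set X}
    {c : ℝ≥0∞} (h : variation μ u U < c) :
    ∃ (v : ℕ → X → ℝ) (g : ℕ → X → ℝ≥0∞), (∀ i, LipLoc (v i) U) ∧
      (∀ i, IsUpperGradient (v i) (g i) U) ∧ TendstoL1Loc μ v u U ∧
      ∀ i, ∫⁻ x in U, g i x ∂μ < c := by
  by_contra! hcon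
  refine h.not_ge (le_variation fun v g hv hg hvu => ?_)
  by_contra! hlt
  obtain ⟨k, hk, hlt⟩ := extraction_of_frequently_atTop (frequently_lt_of_liminf_lt (by
    isBoundedDefault) hlt)
  obtain ⟨i, hi⟩ := hcon (fun i => v (k i)) (fun i => g (k i)) (fun i => hv _) (fun i => hg _)
    (hvu.comp_tendsto hk.tendsto_atTop)
  exact (hlt i).not_ge hi

theorem variation_mono_set [MeasurableSpace X] (μ : Measure X) (u : X → ℝ) {U W : Set X}
    (hUW : U ⊆ W) : variation μ u U ≤ variation μ u W :=
  le_variation fun _ _ hv hg hvu =>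
    (variation_le_liminf (fun i => (hv i).mono hUW) (fun i => (hg i).mono_set hUW)
      (hvu.mono hUW)).trans (liminf_le_liminf (Eventually.of_forall fun _ =>
        lintegral_mono_set hUW))

theorem variation_comp_le [MeasurableSpace X] (μ : Measure X) (u : X → ℝ) (U : Set X) {T : ℝ → ℝ}
    (hT : LipschitzWith 1 T) : variation μ (fun x => T (u x)) U ≤ variation μ u U :=
  le_variation fun _ _ hv hg hvu =>
    variation_le_liminf (fun i => (hv i).comp hT) (fun i => (hg i).comp_lipschitz hT)
      (hvu.comp_lipschitz hT)

theorem variation_add_le [ProperSpace X] [MeasurableSpace X] [BorelSpace X] {μ : Measure X}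
    {u w : X → ℝ} {U : Set X} (hU : IsOpen U) (hu : AEMeasurable u (μ.restrict U)) :
    variation μ (fun x => u x + w x) U ≤ variation μ u U + variation μ w U := by
  refine ENNReal.le_of_forall_pos_le_add fun ε hε hfin => ?_
  have hε2 : (ε / 2 : ℝ≥0∞) ≠ 0 := by simpa using hε.ne'
  obtain ⟨v, g, hv, hg, hvu, hgu⟩ := exists_approx_of_variation_lt
    (ENNReal.lt_add_right (ENNReal.add_lt_top.1 hfin).1.ne hε2)
  obtain ⟨v', g', hv', hg', hvu', hgu'⟩ := exists_approx_of_variation_lt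
    (ENNReal.lt_add_right (ENNReal.add_lt_top.1 hfin).2.ne hε2)
  calc variation μ (fun x => u x + w x) U
      ≤ liminf (fun i => ∫⁻ x in U, (g i x + g' i x) ∂μ) atTop :=
        variation_le_liminf (fun i => (hv i).add (hv' i)) (fun i => (hg i).add (hg' i))
          (hvu.add hvu' (fun i => (hv i).continuousOn hU) hu)
    _ ≤ liminf (fun _ : ℕ => variation μ u U + ε / 2 + (variation μ w U + ε / 2)) atTop := by
        refine liminf_le_liminf (Eventually.of_forall fun i => ?_)
        rw [lintegral_add_left (hg i).1]
        exact add_le_add (hgu i).le (hgu' i).le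
    _ = variation μ u U + variation μ w U + ε := by
        rw [liminf_const, add_add_add_comm, ENNReal.add_halves]

theorem lipschitzWith_neg_real : LipschitzWith 1 (fun t : ℝ => -t) :=
  LipschitzWith.id.neg

theorem variation_sub_le [ProperSpace X] [MeasurableSpace X] [BorelSpace X] {μ : Measure X}
    {u w : X → ℝ} {U : Set X} (hU : IsOpen U) (hu : AEMeasurable u (μ.restrict U)) :
    variation μ (fun x => u x - w x) U ≤ variation μ u U + variation μ w U := by
  simp only [sub_eq_add_neg]
  exact (variation_add_le hU hu).trans
    (by gcongr; exact variation_comp_le μ w U lipschitzWith_neg_real)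

theorem _root_.ENNReal.liminf_add_liminf_le (a b : ℕ → ℝ≥0∞) :
    liminf a atTop + liminf b atTop ≤ liminf (fun i => a i + b i) atTop := by
  have hmono : ∀ c : ℕ → ℝ≥0∞, Monotone fun n => ⨅ i ≥ n, c i :=
    fun c m n hmn => le_iInf₂ fun i hi => iInf₂_le i (hmn.trans hi)
  simp only [liminf_eq_iSup_iInf_of_nat]
  rw [ENNReal.iSup_add_iSup_of_monotone (hmono a) (hmono b)]
  exact iSup_mono fun n => le_iInf₂ fun i hi => add_le_add (iInf₂_le i hi) (iInf₂_le i hi)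

/-- One sequence `v i` approximates both parts at once. The cut-off gradients live on disjoint sets,
so their sum is at most `g i`, and liminf is superadditive. -/
theorem variation_posPart_add_negPart_le [ProperSpace X] [MeasurableSpace X] [BorelSpace X]
    (μ : Measure X) (u : X → ℝ) {U : Set X} (hU : IsOpen U) :
    variation μ (fun x => max (u x) 0) U + variation μ (fun x => max (-u x) 0) U
      ≤ variation μ u U := by
  have hT : LipschitzWith 1 (fun t : ℝ => max t 0) := LipschitzWith.id.max_const 0
  have hT' : LipschitzWith 1 (fun t : ℝ => max (-t) 0) := lipschitzWith_neg_real.max_const 0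
  refine le_variation fun v g hv hg hvu => ?_
  have hc : ∀ i, ContinuousOn (v i) U := fun i => (hv i).continuousOn hU
  set a : ℕ → X → ℝ≥0∞ := fun i => (U ∩ {x | 0 < v i x}).indicator (g i) with ha
  set b : ℕ → X → ℝ≥0∞ := fun i => (U ∩ {x | 0 < -v i x}).indicator (g i) with hb
  have hvp : ∀ i, LipLoc (fun x => max (v i x) 0) U := fun i => LipLoc.comp (hv i) hT
  have hvn : ∀ i, LipLoc (fun x => max (-v i x) 0) U := fun i => LipLoc.comp (hv i) hT'
  have hgp : ∀ i, IsUpperGradient (fun x => max (v i x) 0) (a i) U :=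
    fun i => (hg i).posPart hU (hc i)
  have hgn : ∀ i, IsUpperGradient (fun x => max (-v i x) 0) (b i) U := fun i =>
    IsUpperGradient.posPart (v := fun x => -v i x)
      ((hg i).comp_lipschitz lipschitzWith_neg_real) hU (hc i).neg
  have hup := TendstoL1Loc.comp_lipschitz hvu hT
  have hun := TendstoL1Loc.comp_lipschitz hvu hT'
  have h1 := variation_le_liminf hvp hgp hup
  have h2 := variation_le_liminf hvn hgn hun
  have hab : ∀ i x, a i x + b i x ≤ g i x := by
    intro i x
    by_cases h : 0 < v i x
    · have h' : x ∉ U ∩ {x | 0 < -v i x} := fun hx => by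
        have : 0 < -v i x := hx.2
        linarith
      simp only [hb]
      rw [indicator_of_notMem h', add_zero]
      exact indicator_le_self _ _ x
    · have h' : x ∉ U ∩ {x | 0 < v i x} := fun hx => h hx.2
      simp only [ha]
      rw [indicator_of_notMem h', zero_add]
      exact indicator_le_self _ _ x
  calc variation μ (fun x => max (u x) 0) U + variation μ (fun x => max (-u x) 0) U
      ≤ liminf (fun i => ∫⁻ x in U, a i x ∂μ) atTop + liminf (fun i => ∫⁻ x in U, b i x ∂μ) atTop :=
        add_le_add h1 h2
    _ ≤ liminf (fun i => (∫⁻ x in U, a i x ∂μ) + ∫⁻ x in U, b i x ∂μ) atTop :=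
        ENNReal.liminf_add_liminf_le _ _
    _ ≤ liminf (fun i => ∫⁻ x in U, g i x ∂μ) atTop :=
        liminf_le_liminf (Eventually.of_forall fun i =>
          (le_lintegral_add _ _).trans (lintegral_mono (hab i)))

theorem MemBV.mono [MeasurableSpace X] {μ : Measure X} {u : X → ℝ} {U W : Set X}
    (h : MemBV μ u W) (hUW : U ⊆ W) : MemBV μ u U :=
  ⟨h.1.mono_set hUW, (variation_mono_set μ u hUW).trans_lt h.2⟩

theorem MemBV.memBVLoc [MeasurableSpace X] {μ : Measure X} {u : X → ℝ} {U : Set X}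
    (h : MemBV μ u U) : MemBVLoc μ u U :=
  fun _ hV => h.mono hV.subset

theorem MemBV.add [ProperSpace X] [MeasurableSpace X] [BorelSpace X] {μ : Measure X} {u w : X → ℝ}
    {U : Set X} (hU : IsOpen U) (hu : MemBV μ u U) (hw : MemBV μ w U) :
    MemBV μ (fun x => u x + w x) U :=
  ⟨hu.1.add hw.1, (variation_add_le hU hu.1.aemeasurable).trans_lt
    (ENNReal.add_lt_top.2 ⟨hu.2, hw.2⟩)⟩

theorem MemBV.sub [ProperSpace X] [MeasurableSpace X] [BorelSpace X] {μ : Measure X} {u w : X → ℝ}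
    {U : Set X} (hU : IsOpen U) (hu : MemBV μ u U) (hw : MemBV μ w U) :
    MemBV μ (fun x => u x - w x) U :=
  ⟨hu.1.sub hw.1, (variation_sub_le hU hu.1.aemeasurable).trans_lt
    (ENNReal.add_lt_top.2 ⟨hu.2, hw.2⟩)⟩

theorem MemBV.comp_lipschitz [MeasurableSpace X] {μ : Measure X} {u : X → ℝ} {U : Set X}
    (h : MemBV μ u U) {T : ℝ → ℝ} (hT : LipschitzWith 1 T) (hT0 : T 0 = 0) :
    MemBV μ (fun x => T (u x)) U := by
  refine ⟨Integrable.mono h.1 (hT.continuous.comp_aestronglyMeasurable h.1.aestronglyMeasurable)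
    (Eventually.of_forall fun x => ?_), (variation_comp_le μ u U hT).trans_lt h.2⟩
  simpa [hT0] using hT.dist_le_mul (u x) 0

/-- By truncation, it suffices to test the least gradient property of a function with values in
`[0, 1]` with competitors taking values in `[0, 1]`. -/
theorem isLeastGradient_of_forall_le [ProperSpace X] [MeasurableSpace X] [BorelSpace X]
    {μ : Measure X} {a : X → ℝ} {U : Set X} (hU : IsOpen U) (ha : MemBV μ a U)
    (ha01 : ∀ x, 0 ≤ a x ∧ a x ≤ 1)
    (hmin : ∀ w : X → ℝ, MemBV μ w U → (∀ x, 0 ≤ w x ∧ w x ≤ 1) →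
      (∃ K, IsCompact K ∧ K ⊆ U ∧ ∀ x ∈ U \ K, w x = a x) → variation μ a U ≤ variation μ w U) :
    IsLeastGradient μ a U := by
  refine ⟨ha.memBVLoc, fun φ hφ ⟨K, hK, hKU, hφ0⟩ => ?_⟩
  -- Clipping to `[0, 1]` fixes the values of `a`, so the clipped competitor still equals `a` off
  -- `K`, and its variation does not increase.
  have hT : LipschitzWith 1 (fun t : ℝ => max 0 (min 1 t)) :=
    (LipschitzWith.id.const_min 1).const_max 0
  refine le_trans ?_ (variation_comp_le μ (fun x => a x + φ x) U hT)
  refine hmin _ ((ha.add hU hφ).comp_lipschitz hT (by norm_num)) (fun x => ⟨le_max_left _ _,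
    max_le zero_le_one (min_le_left _ _)⟩) ⟨K, hK, hKU, fun x hx => ?_⟩
  rw [hφ0 x hx, add_zero, min_eq_right (ha01 x).2, max_eq_right (ha01 x).1]

/-! ### Traces -/

theorem trace_congr [MeasurableSpace X] [BorelSpace X] {μ : Measure X} {Ω K : Set X}
    (hΩ : IsOpen Ω) {u v : X → ℝ} (hK : IsClosed K) (huv : ∀ x ∈ Ω \ K, u x = v x) {x : X}
    (hx : x ∉ K) : trace μ Ω u x = trace μ Ω v x := by
  obtain ⟨ε, hε, hsub⟩ := Metric.isOpen_iff.1 hK.isOpen_compl x hx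
  -- The trace is picked by choice, so the two predicates in `t` are shown equal: then the chosen
  -- values, or the default `0`, coincide even without uniqueness of the trace.
  have key : IsTrace μ Ω u x = IsTrace μ Ω v x := by
    funext t
    refine propext (tendsto_congr' ?_)
    filter_upwards [Ioo_mem_nhdsGT hε] with r hr
    refine laverage_congr (ae_restrict_of_forall_mem
      (measurableSet_ball.inter hΩ.measurableSet) fun y hy => ?_)
    dsimp only
    rw [huv y ⟨hy.2, hsub (ball_subset_ball hr.2.le hy.1)⟩]
  unfold trace
  rw [key]

theorem disjoint_measureBoundary [MeasurableSpace X] (μ : Measure X) {Ω : Set X}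
    (hΩ : IsOpen Ω) : Disjoint (measureBoundary μ Ω) Ω := by
  refine Set.disjoint_left.2 fun x hx hxΩ => hx.2.ne' ?_
  obtain ⟨ε, hε, hsub⟩ := Metric.isOpen_iff.1 hΩ x hxΩ
  have : (fun r : ℝ => μ (ball x r \ Ω) / μ (ball x r)) =ᶠ[𝓝[>] 0] fun _ => 0 := by
    filter_upwards [Ioo_mem_nhdsGT hε] with r hr
    rw [sdiff_eq_empty.2 ((ball_subset_ball hr.2.le).trans hsub), measure_empty, ENNReal.zero_div]
  rw [limsup_congr this, limsup_const]

theorem setIntegral_trace_mul_congr [MeasurableSpace X] [BorelSpace X] {μ : Measure X}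
    {Ω K : Set X} (hΩ : IsOpen Ω) {u v : X → ℝ} (hK : IsClosed K) (hKΩ : K ⊆ Ω)
    (huv : ∀ x ∈ Ω \ K, u x = v x) (f : X → ℝ) (ν : Measure X) :
    ∫ x in measureBoundary μ Ω, trace μ Ω u x * f x ∂ν =
      ∫ x in measureBoundary μ Ω, trace μ Ω v x * f x ∂ν := by
  -- The integrands agree on the whole of `Ωᶜ`, which is measurable and contains `∂^*Ω`;
  -- measurability of `∂^*Ω` is not needed.
  refine integral_congr_ae (ae_restrict_of_ae_restrict_of_subset
    (disjoint_measureBoundary μ hΩ).subset_compl_right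
    (ae_restrict_of_forall_mem hΩ.measurableSet.compl fun x hx => ?_))
  dsimp only
  rw [trace_congr hΩ hK huv fun hxK => hx (hKΩ hxK)]

/-- A solution of the restricted Neumann problem minimizes the total variation among the
admissible functions which agree with it near the boundary. -/
theorem SolvesRestrictedNeumann.variation_le [MeasurableSpace X] [BorelSpace X] {μ : Measure X}
    {Ω K : Set X} {f u v : X → ℝ} (h : SolvesRestrictedNeumann μ Ω f u) (hΩ : IsOpen Ω)
    (hv : MemBV μ v Ω) (hv1 : ∀ x ∈ Ω, -1 ≤ v x ∧ v x ≤ 1) (hK : IsClosed K) (hKΩ : K ⊆ Ω)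
    (huv : ∀ x ∈ Ω \ K, u x = v x) : variation μ u Ω ≤ variation μ v Ω := by
  have h1 := h.2.2 v hv hv1
  unfold neumannFunctional at h1
  -- The two boundary terms are the same real number, so they cancel without any integrability of
  -- the trace.
  rw [setIntegral_trace_mul_congr hΩ hK hKΩ huv] at h1
  exact (ENNReal.toReal_le_toReal h.1.2.ne hv.2.ne).1 (le_of_add_le_add_right h1)

end MetricBV

namespace MetricBV

variable {X : Type*}

/-! ### Characteristic functions of disjoint sets as positive and negative parts -/

theorem chi_nonneg_and_le_one (E : Set X) (x : X) : 0 ≤ chi E x ∧ chi E x ≤ 1 := by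
  unfold chi indicator
  split_ifs <;> norm_num

theorem posPart_chi_sub_chi {E F : Set X} (h : Disjoint E F) :
    (fun x => max (chi E x - chi F x) 0) = chi E := by
  funext x
  by_cases hE : x ∈ E
  · have hF : x ∉ F := Set.disjoint_left.1 h hE
    simp [chi, hE, hF]
  · by_cases hF : x ∈ F <;> simp [chi, hE, hF]

theorem negPart_chi_sub_chi {E F : Set X} (h : Disjoint E F) :
    (fun x => max (-(chi E x - chi F x)) 0) = chi F := by
  simp only [neg_sub]
  exact posPart_chi_sub_chi h.symm

end MetricBV

/-! ### The least gradient property of the two sets -/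

theorem mainTheorem7 {X : Type*} [MetricSpace X] [CompleteSpace X] [Nontrivial X]
    [MeasurableSpace X] [BorelSpace X] (μ : Measure X)
    (hdoubling : MetricBV.IsDoubling μ) (hpoincare : MetricBV.SupportsPoincare μ)
    (Ω : Set X) (hopen : IsOpen Ω) (hne : Ω.Nonempty) (hbdd : Bornology.IsBounded Ω)
    (hper : MetricBV.variation μ (MetricBV.chi Ω) univ < ∞)
    (htrace : ∀ u : X → ℝ, MetricBV.MemBV μ u Ω →
      MetricBV.codimOneHausdorff μ
        {x ∈ MetricBV.measureBoundary μ Ω | ¬ ∃ t, MetricBV.IsTrace μ Ω u x t} = 0)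
    (f : X → ℝ)
    (hf : IntegrableOn f (MetricBV.measureBoundary μ Ω) (MetricBV.perimeterMeasure μ Ω))
    (hf0 : ∫ x in MetricBV.measureBoundary μ Ω, f x ∂(MetricBV.perimeterMeasure μ Ω) = 0)
    (E₁ E₂ : Set X) (hE₁ : E₁ ⊆ Ω) (hE₂ : E₂ ⊆ Ω) (hdisj : Disjoint E₁ E₂)
    (hsol : MetricBV.SolvesRestrictedNeumann μ Ω f
      (fun x => MetricBV.chi E₁ x - MetricBV.chi E₂ x)) :
    (MetricBV.MemBV μ (MetricBV.chi E₁) Ω ∧ MetricBV.IsLeastGradient μ (MetricBV.chi E₁) Ω) ∧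
    (MetricBV.MemBV μ (MetricBV.chi E₂) Ω ∧ MetricBV.IsLeastGradient μ (MetricBV.chi E₂) Ω) := by
  have : ProperSpace X := hdoubling.properSpace
  have hu := hsol.1
  have hT : LipschitzWith 1 (fun t : ℝ => max t 0) := LipschitzWith.id.max_const 0
  have h1 : MetricBV.MemBV μ (MetricBV.chi E₁) Ω := by
    have := hu.comp_lipschitz hT (max_self 0)
    rwa [MetricBV.posPart_chi_sub_chi hdisj] at this
  have h2 : MetricBV.MemBV μ (MetricBV.chi E₂) Ω := by
    have := hu.comp_lipschitz (MetricBV.lipschitzWith_neg_real.max_const 0) (by simp)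
    rwa [MetricBV.negPart_chi_sub_chi hdisj] at this
  have hsum := MetricBV.variation_posPart_add_negPart_le μ
    (fun x => MetricBV.chi E₁ x - MetricBV.chi E₂ x) hopen
  rw [MetricBV.posPart_chi_sub_chi hdisj, MetricBV.negPart_chi_sub_chi hdisj] at hsum
  refine ⟨⟨h1, MetricBV.isLeastGradient_of_forall_le hopen h1
    (MetricBV.chi_nonneg_and_le_one E₁) ?_⟩, ⟨h2, MetricBV.isLeastGradient_of_forall_le hopen h2
    (MetricBV.chi_nonneg_and_le_one E₂) ?_⟩⟩
  · rintro w hw hw01 ⟨K, hK, hKΩ, hwK⟩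
    -- `w` need not vanish on `E₂`: a difference of two functions with values in `[0, 1]` is
    -- admissible anyway.
    have hle := hsol.variation_le hopen (hw.sub hopen h2) (fun x _ => by
      have ha := hw01 x
      have hb := MetricBV.chi_nonneg_and_le_one E₂ x
      constructor <;> linarith) hK.isClosed hKΩ fun x hx => by rw [hwK x hx]
    exact (ENNReal.add_le_add_iff_right h2.2.ne).1
      (hsum.trans (hle.trans (MetricBV.variation_sub_le hopen hw.1.aemeasurable)))
  · rintro w hw hw01 ⟨K, hK, hKΩ, hwK⟩
    have hle := hsol.variation_le hopen (h1.sub hopen hw) (fun x _ => by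
      have ha := hw01 x
      have hb := MetricBV.chi_nonneg_and_le_one E₁ x
      constructor <;> linarith) hK.isClosed hKΩ fun x hx => by rw [hwK x hx]
    exact (ENNReal.add_le_add_iff_left h1.2.ne).1
      (hsum.trans (hle.trans (MetricBV.variation_sub_le hopen h1.1.aemeasurable)))
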